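/- Consider continuous-time ski rental with buying cost $1$. A (randomized) strategy is a probability distribution $\mu$ on $[0,\infty)$, the law of the purchase day $X$. If the ski season lasts for a time $s>0$, the strategy pays the random cost $$C(X,s)=s\cdot\mathbf 1_{X>s}+(X+1)\cdot\mathbf 1_{X\le s},$$ whereas the offline optimal cost is $\min\{s,1\}$. For $\delta\in[0,1)$ let $$\mathrm{CVaR}_\delta[Z]=\inf_{t\in\mathbb R}\Bigl\{t+\tfrac1{1-\delta}\,\mathbb E[(Z-t)^+]\Bigr\},\qquad \alpha_\delta^{\mu}=\sup_{s>0}\frac{\mathrm{CVaR}_\delta[C(X,s)]}{\min\{s,1\}}\in[0,\infty],\qquad \alpha_\delta^*=\inf_\mu \alpha_\delta^\mu ,$$ where $X\sim\mu$ and the infimum is over all strategies; a strategy $\mu$ is optimal if $\alpha_\delta^\mu=\alpha_\delta^*$. **Theorem.** Let $\delta\in[0,1)$. Then $\alpha:=\alpha_\delta^*$ is a real number greater than $1$, and the delay differential equation $$\phi'(t)=\frac{1}{\alpha(1-\delta)}\bigl[\phi(t)-\phi(t-(1-\delta))\bigr]\quad\text{for } t\in[1-\delta,1],$$ (with one-sided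 derivatives at the endpoints; no condition if $\delta=0$), with initial condition $$\phi(t)=\log\Bigl(1+\frac{t}{(\alpha-1)(1-\delta)}\Bigr)\quad\text{for } t\in[0,1-\delta],$$ has exactly one solution $\phi$ on $[0,1]$. It takes values in $[0,1]$. Moreover there is exactly one optimal strategy $\mu$; it is supported in $[0,1]$, and $\phi$ is its inverse CDF: $\phi(p)=\inf\{x\in[0,1]:\mu((-\infty,x])\ge p\}$ for all $p\in[0,1]$. -/

import Mathlib

open MeasureTheory Set

namespace SkiRental

noncomputable section

/-- The conditional value-at-risk `CVaR_δ[Z]` of a (bounded) random loss `Z` on the probability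
space `(Ω, μ)`, for `δ ∈ [0, 1)`: the infimum over `t` of `t + E[(Z - t)⁺] / (1 - δ)`. -/
def cvar {Ω : Type*} [MeasurableSpace Ω] (δ : ℝ) (μ : Measure Ω) (Z : Ω → ℝ) : ℝ :=
  ⨅ t : ℝ, t + (1 - δ)⁻¹ * ∫ ω, max (Z ω - t) 0 ∂μ

/-- The cost of renting until day `x` and then buying (at price `1`), when the season lasts for a
time `s`. -/
def cost (s x : ℝ) : ℝ := if s < x then s else x + 1

/-- A randomized strategy: the law of the random purchase day, a probability distribution on the
nonnegative reals. -/
def IsStrategy (μ : Measure ℝ) : Prop :=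
  IsProbabilityMeasure μ ∧ ∀ᵐ x ∂μ, 0 ≤ x

/-- The ratio of the `CVaR_δ` of the cost of the strategy `μ` to the offline optimal cost
`min {s, 1}`, for a season of duration `s`. -/
def ratio (δ : ℝ) (μ : Measure ℝ) (s : ℝ) : ℝ :=
  cvar δ μ (cost s) / min s 1

/-- The `CVaR_δ`-competitive ratio of the strategy `μ`; it may be infinite. -/
def compRatio (δ : ℝ) (μ : Measure ℝ) : EReal :=
  ⨆ s ∈ Ioi (0 : ℝ), (ratio δ μ s : EReal)

/-- The smallest `CVaR_δ`-competitive ratio of any strategy. -/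
def optRatio (δ : ℝ) : EReal :=
  ⨅ (μ : Measure ℝ) (_ : IsStrategy μ), compRatio δ μ

/-- `μ` is an optimal strategy for the `CVaR_δ`-competitive ratio. -/
def IsOptimal (δ : ℝ) (μ : Measure ℝ) : Prop :=
  IsStrategy μ ∧ compRatio δ μ = optRatio δ

/-- The inverse CDF of a distribution `μ` on `ℝ` that is supported in `[a, b]`. -/
def inverseCDF (a b : ℝ) (μ : Measure ℝ) (p : ℝ) : ℝ :=
  sInf {x ∈ Icc a b | p ≤ ProbabilityTheory.cdf μ x}

/-- `φ` solves, on `[0, 1]`, the delay differential equation with parameters `δ` and `α`. The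
derivative is taken within `[1 - δ, 1]`, so it is one-sided at the two endpoints (and the equation
is void when `δ = 0`, where the initial segment is all of `[0, 1]`). -/
structure IsDelaySolution (δ α : ℝ) (φ : ℝ → ℝ) : Prop where
  initial : ∀ t ∈ Icc 0 (1 - δ), φ t = Real.log (1 + t / ((α - 1) * (1 - δ)))
  delay : ∀ t ∈ Icc (1 - δ) 1,
    HasDerivWithinAt φ (1 / (α * (1 - δ)) * (φ t - φ (t - (1 - δ)))) (Icc (1 - δ) 1) t

end

end SkiRental

/-!
Write `β = 1 - δ`, and let `φ` be the inverse CDF of a strategy supported in `[0, 1]`. In a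
season of length `s = φ t ≤ 1`, a purchase at time `x ≤ s` costs `x + 1 ≥ s`, and later purchases
cost `s`. So the worst `β` fraction of the costs consists of `φ u + 1` for `u ∈ [(t - β)⁺, t]`,
filled up with copies of `s` if `t < β`. Requiring that the resulting CVaR be exactly `α * s` for every `t` gives the linear
Volterra equation
`(α β - (β - t)⁺) * φ t = ∫ u in (t - β)⁺..t, (φ u + 1)`,
and the delay differential equation, with its initial segment, is the derivative of this equation
(`IsDelaySolution.volterra`).

The Volterra kernel is positive, so subsolutions stay below supersolutions
(`volterra_comparison`). This gives uniqueness of the delay solution and shows that `φ 1` is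
strictly decreasing and Lipschitz in `α`; hence there is exactly one `α` with `φ 1 = 1`
(`exists_isDelaySolution_one_eq_one`), and for it the law of `φ U`, with `U` uniform on `(0, 1)`,
attains the ratio `α` (`IsDelaySolution.compRatio_uniformLaw_le`).

Conversely, any strategy is the law of `g U`, where `g` is its quantile function. If its ratio is at
most `α'`, then `min g 1` is a supersolution for `α'` (`cap_supersolution`), because the average of
the cost over any event of probability `β` bounds the CVaR from below. So the delay solution for
`α'` is at most `1` at time `1`, which forces `α ≤ α'`. If the ratio is `α` itself, the
supersolution touches the solution at time `1`, and contact spreads backwards to the whole interval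
(`eqOn_of_supersolution_of_eq_one`); so `g = φ` on `(0, 1)`, which is uniqueness.
-/

namespace SkiRental

/-! ### The Volterra equation and its comparison principle -/

/-- A Gronwall inequality for bounded functions that need not be continuous: iterating the
hypothesis bounds `f t` by `M * (K * t) ^ n / n!` for every `n`. -/
theorem nonpos_of_le_mul_integral {f : ℝ → ℝ} {K M T : ℝ} (hK : 0 ≤ K)
    (hf : IntervalIntegrable f volume 0 T) (hM : ∀ t ∈ Icc 0 T, f t ≤ M)
    (h : ∀ t ∈ Icc 0 T, f t ≤ K * ∫ u in (0 : ℝ)..t, f u) :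
    ∀ t ∈ Icc 0 T, f t ≤ 0 := by
  have key : ∀ n : ℕ, ∀ t ∈ Icc 0 T, f t ≤ M * ((K * t) ^ n / n.factorial) := by
    intro n
    induction n with
    | zero => simpa using hM
    | succ n ih =>
      intro t ht
      have hint : ∫ u in (0 : ℝ)..t, f u ≤ ∫ u in (0 : ℝ)..t, M * ((K * u) ^ n / n.factorial) := by
        refine intervalIntegral.integral_mono_on ht.1 (hf.mono_set ?_) ?_ ?_
        · rw [uIcc_of_le ht.1, uIcc_of_le (ht.1.trans ht.2)]
          exact Icc_subset_Icc_right ht.2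
        · exact Continuous.intervalIntegrable (by fun_prop) _ _
        · exact fun u hu ↦ ih u ⟨hu.1, hu.2.trans ht.2⟩
      have hval : ∫ u in (0 : ℝ)..t, M * ((K * u) ^ n / n.factorial)
          = M * (K ^ n * (t ^ (n + 1) / (n + 1)) / n.factorial) := by
        simp only [mul_pow, intervalIntegral.integral_const_mul, intervalIntegral.integral_div,
          integral_pow]
        simp
      refine (h t ht).trans ((mul_le_mul_of_nonneg_left (hint.trans_eq hval) hK).trans_eq ?_)
      have : (n.factorial : ℝ) ≠ 0 := by positivity
      have : (n : ℝ) + 1 ≠ 0 := by positivity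
      rw [Nat.factorial_succ]
      push_cast
      field_simp
      ring
  intro t ht
  refine ge_of_tendsto' (x := Filter.atTop) ?_ (fun n ↦ key n t ht)
  simpa using (FloorSemiring.tendsto_pow_div_factorial_atTop (K * t)).const_mul M

/-- The coefficient `α β - (β - t)⁺` of `φ t` in the Volterra equation
`coeff α β t * φ t = ∫ u in (t - β)⁺..t, (φ u + 1)`. With `β = 1 - δ`, this equation says that a
season of length `φ t` costs the strategy with inverse CDF `φ` exactly `α` times `φ t`. -/
noncomputable def coeff (α β t : ℝ) : ℝ := α * β - max (β - t) 0

theorem coeff_ge {α β t : ℝ} (hβ : 0 < β) (ht : 0 ≤ t) : (α - 1) * β ≤ coeff α β t := by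
  unfold coeff
  have : max (β - t) 0 ≤ β := max_le (by linarith) hβ.le
  linarith

theorem coeff_pos {α β t : ℝ} (hα : 1 < α) (hβ : 0 < β) (ht : 0 ≤ t) : 0 < coeff α β t :=
  (mul_pos (by linarith) hβ).trans_le (coeff_ge hβ ht)

theorem coeff_of_le {α β t : ℝ} (ht : t ≤ β) : coeff α β t = α * β - β + t := by
  rw [coeff, max_eq_left (by linarith)]; ring

theorem coeff_of_ge {α β t : ℝ} (ht : β ≤ t) : coeff α β t = α * β := by
  rw [coeff, max_eq_right (by linarith), sub_zero]

theorem max_sub_mem_Icc {β t : ℝ} (hβ : 0 < β) (ht : 0 ≤ t) : max (t - β) 0 ∈ Icc 0 t :=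
  ⟨le_max_right _ _, max_le (by linarith) ht⟩

theorem uIcc_subset_Icc_of_mem {a b T : ℝ} (ha : a ∈ Icc 0 T) (hb : b ∈ Icc 0 T) :
    uIcc a b ⊆ uIcc 0 T := by
  rw [uIcc_of_le (ha.1.trans ha.2)]
  exact (ordConnected_Icc).uIcc_subset ha hb

theorem intervalIntegrable_delay {f : ℝ → ℝ} {β T t : ℝ} (hβ : 0 < β)
    (hf : IntervalIntegrable f volume 0 T) (ht : t ∈ Icc 0 T) :
    IntervalIntegrable f volume (max (t - β) 0) t :=
  hf.mono_set (uIcc_subset_Icc_of_mem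
    (Icc_subset_Icc_right ht.2 (max_sub_mem_Icc hβ ht.1)) ht)

/-- A subsolution `f` of the Volterra equation stays below a supersolution `g`. -/
theorem volterra_comparison {f g : ℝ → ℝ} {α β T M : ℝ} (hα : 1 < α) (hβ : 0 < β)
    (hf : IntervalIntegrable f volume 0 T) (hg : IntervalIntegrable g volume 0 T)
    (hM : ∀ t ∈ Icc 0 T, f t - g t ≤ M)
    (hsub : ∀ t ∈ Icc 0 T, coeff α β t * f t ≤ ∫ u in (max (t - β) 0)..t, (f u + 1))
    (hsup : ∀ t ∈ Icc 0 T, ∫ u in (max (t - β) 0)..t, (g u + 1) ≤ coeff α β t * g t) :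
    ∀ t ∈ Icc 0 T, f t ≤ g t := by
  have hb : 0 < (α - 1) * β := mul_pos (by linarith) hβ
  have hd : IntervalIntegrable (fun u ↦ f u - g u) volume 0 T := hf.sub hg
  have hp : IntervalIntegrable (fun u ↦ max (f u - g u) 0) volume 0 T :=
    ⟨hd.1.pos_part, hd.2.pos_part⟩
  have key : ∀ t ∈ Icc 0 T, max (f t - g t) 0 ≤ 0 := by
    refine nonpos_of_le_mul_integral (K := ((α - 1) * β)⁻¹) (M := max M 0) (by positivity) hp
      (fun t ht ↦ max_le_max_right 0 (hM t ht)) ?_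
    intro t ht
    have hmem := max_sub_mem_Icc hβ ht.1
    have hpt : IntervalIntegrable (fun u ↦ max (f u - g u) 0) volume 0 t :=
      hp.mono_set (uIcc_subset_Icc_of_mem ⟨le_rfl, ht.1.trans ht.2⟩ ht)
    have h0 : 0 ≤ ∫ u in (0 : ℝ)..t, max (f u - g u) 0 :=
      intervalIntegral.integral_nonneg ht.1 (fun u _ ↦ le_max_right _ _)
    refine max_le ?_ (by positivity)
    rcases le_or_gt (f t - g t) 0 with hneg | hpos
    · exact hneg.trans (by positivity)
    rw [← div_eq_inv_mul, le_div_iff₀' hb]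
    have h1 : coeff α β t * (f t - g t) ≤ ∫ u in (max (t - β) 0)..t, (f u - g u) := by
      have e : ∫ u in (max (t - β) 0)..t, (f u - g u)
          = (∫ u in (max (t - β) 0)..t, (f u + 1)) - ∫ u in (max (t - β) 0)..t, (g u + 1) := by
        rw [← intervalIntegral.integral_sub
          ((intervalIntegrable_delay hβ hf ht).add intervalIntegrable_const)
          ((intervalIntegrable_delay hβ hg ht).add intervalIntegrable_const)]
        simp
      rw [e]
      linarith [hsub t ht, hsup t ht]
    have h2 : ∫ u in (max (t - β) 0)..t, (f u - g u)
        ≤ ∫ u in (max (t - β) 0)..t, max (f u - g u) 0 :=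
      intervalIntegral.integral_mono_on hmem.2 (intervalIntegrable_delay hβ hd ht)
        (intervalIntegrable_delay hβ hp ht) (fun u _ ↦ le_max_left _ _)
    have h3 : ∫ u in (max (t - β) 0)..t, max (f u - g u) 0
        ≤ ∫ u in (0 : ℝ)..t, max (f u - g u) 0 :=
      intervalIntegral.integral_mono_interval hmem.1 hmem.2 le_rfl
        (Filter.Eventually.of_forall fun u ↦ le_max_right _ _) hpt
    have h4 : (α - 1) * β * (f t - g t) ≤ coeff α β t * (f t - g t) :=
      mul_le_mul_of_nonneg_right (coeff_ge hβ ht.1) hpos.le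
    linarith
  intro t ht
  linarith [le_max_left (f t - g t) 0, key t ht]

/-! ### The delay differential equation -/

theorem IsDelaySolution.continuousOn {δ α : ℝ} {φ : ℝ → ℝ} (hα : 1 < α) (hδ0 : 0 ≤ δ)
    (hδ1 : δ < 1) (h : IsDelaySolution δ α φ) : ContinuousOn φ (Icc 0 1) := by
  have hβ : 0 < 1 - δ := by linarith
  rw [← Icc_union_Icc_eq_Icc hβ.le (by linarith : 1 - δ ≤ 1)]
  refine ContinuousOn.union_of_isClosed ?_ (fun t ht ↦ (h.delay t ht).continuousWithinAt)
    isClosed_Icc isClosed_Icc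
  refine ContinuousOn.congr ?_ h.initial
  refine ContinuousOn.log (by fun_prop) fun t ht ↦ ?_
  have : 0 ≤ t / ((α - 1) * (1 - δ)) := div_nonneg ht.1 (mul_pos (by linarith) hβ).le
  positivity

/-- The initial segment solves `φ' = 1 / coeff`. -/
theorem IsDelaySolution.hasDerivWithinAt_initial {δ α : ℝ} {φ : ℝ → ℝ} (hα : 1 < α)
    (hδ1 : δ < 1) (h : IsDelaySolution δ α φ) {t : ℝ} (ht : t ∈ Icc 0 (1 - δ)) :
    HasDerivWithinAt φ (1 / coeff α (1 - δ) t) (Icc 0 (1 - δ)) t := by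
  have hβ : 0 < 1 - δ := by linarith
  have hb : 0 < (α - 1) * (1 - δ) := mul_pos (by linarith) hβ
  have hpos : 0 < 1 + t / ((α - 1) * (1 - δ)) := by
    have := div_nonneg ht.1 hb.le
    positivity
  have h1 : HasDerivAt (fun t ↦ Real.log (1 + t / ((α - 1) * (1 - δ))))
      (1 / ((α - 1) * (1 - δ)) / (1 + t / ((α - 1) * (1 - δ)))) t :=
    (((hasDerivAt_id t).div_const _).const_add 1).log hpos.ne'
  have e : 1 / ((α - 1) * (1 - δ)) / (1 + t / ((α - 1) * (1 - δ))) = 1 / coeff α (1 - δ) t := by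
    rw [coeff_of_le ht.2, div_div, mul_add, mul_one, mul_div_cancel₀ _ hb.ne']
    congr 1
    ring
  rw [e] at h1
  exact (h1.hasDerivWithinAt).congr h.initial (h.initial t ht)

theorem IsDelaySolution.zero {δ α : ℝ} {φ : ℝ → ℝ} (hδ1 : δ < 1) (h : IsDelaySolution δ α φ) :
    φ 0 = 0 := by
  rw [h.initial 0 ⟨le_rfl, by linarith⟩]; simp

theorem hasDerivWithinAt_integral {f : ℝ → ℝ} (hf : ContinuousOn f (Icc 0 1)) {t : ℝ}
    (ht : t ∈ Icc (0 : ℝ) 1) :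
    HasDerivWithinAt (fun t ↦ ∫ u in (0 : ℝ)..t, f u) (f t) (Icc 0 1) t := by
  have : Fact (t ∈ Icc (0 : ℝ) 1) := ⟨ht⟩
  refine intervalIntegral.integral_hasDerivWithinAt_right (s := Icc 0 1) (t := Icc 0 1) ?_ ?_
    (hf t ht)
  · exact (hf.mono (by rw [uIcc_of_le ht.1]; exact Icc_subset_Icc_right ht.2)).intervalIntegrable
  · exact hf.stronglyMeasurableAtFilter_nhdsWithin measurableSet_Icc t

theorem eq_of_hasDerivWithinAt_zero {f : ℝ → ℝ} {a b : ℝ}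
    (hf : ∀ t ∈ Icc a b, HasDerivWithinAt f 0 (Icc a b) t) : ∀ t ∈ Icc a b, f t = f a := by
  refine constant_of_has_deriv_right_zero (fun t ht ↦ (hf t ht).continuousWithinAt) ?_
  intro t ht
  exact (hf t ⟨ht.1, ht.2.le⟩).mono_of_mem_nhdsWithin (Icc_mem_nhdsGE_of_mem ht)

/-- Every delay solution solves the Volterra equation: both sides vanish at `0` and have the same
derivative on `[0, 1 - δ]` and on `[1 - δ, 1]`. -/
theorem IsDelaySolution.volterra {δ α : ℝ} {φ : ℝ → ℝ} (hα : 1 < α) (hδ0 : 0 ≤ δ)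
    (hδ1 : δ < 1) (h : IsDelaySolution δ α φ) {t : ℝ} (ht : t ∈ Icc (0 : ℝ) 1) :
    coeff α (1 - δ) t * φ t = ∫ u in (max (t - (1 - δ)) 0)..t, (φ u + 1) := by
  have hβ : 0 < 1 - δ := by linarith
  have hβ1 : 1 - δ ≤ 1 := by linarith
  have hc := h.continuousOn hα hδ0 hδ1
  have hc1 : ContinuousOn (fun u ↦ φ u + 1) (Icc 0 1) := hc.add continuousOn_const
  have hint := fun t ht ↦ hasDerivWithinAt_integral hc1 (t := t) ht
  have H1 : ∀ t ∈ Icc 0 (1 - δ), coeff α (1 - δ) t * φ t - ∫ u in (0 : ℝ)..t, (φ u + 1) = 0 := by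
    intro t ht
    have := eq_of_hasDerivWithinAt_zero (a := 0) (b := 1 - δ)
      (f := fun t ↦ (α * (1 - δ) - (1 - δ) + t) * φ t - ∫ u in (0 : ℝ)..t, (φ u + 1)) ?_ t ht
    · simpa [h.zero hδ1, coeff_of_le ht.2] using this
    intro t ht
    have h1 := (((hasDerivAt_id t).const_add (α * (1 - δ) - (1 - δ))).hasDerivWithinAt.mul
      (h.hasDerivWithinAt_initial hα hδ1 ht)).sub
      ((hint t ⟨ht.1, ht.2.trans hβ1⟩).mono (Icc_subset_Icc_right hβ1))
    refine h1.congr_deriv ?_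
    have := (coeff_pos hα hβ ht.1 : 0 < coeff α (1 - δ) t).ne'
    simp only [id]
    rw [coeff_of_le ht.2] at this ⊢
    rw [mul_one_div_cancel this]
    ring
  rcases le_total t (1 - δ) with hle | hge
  · have := H1 t ⟨ht.1, hle⟩
    rw [max_eq_right (by linarith)]
    linarith
  have hβα : 0 < α * (1 - δ) := mul_pos (by linarith) hβ
  have H2 := eq_of_hasDerivWithinAt_zero (a := 1 - δ) (b := 1)
      (f := fun t ↦ α * (1 - δ) * φ t
        - ((∫ u in (0 : ℝ)..t, (φ u + 1)) - ∫ u in (0 : ℝ)..(t - (1 - δ)), (φ u + 1))) ?_ t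
    ⟨hge, ht.2⟩
  · have H3 := H1 (1 - δ) ⟨hβ.le, le_rfl⟩
    rw [coeff_of_ge le_rfl] at H3
    simp only [sub_self, intervalIntegral.integral_same, sub_zero, H3] at H2
    rw [coeff_of_ge hge, max_eq_left (by linarith)]
    rw [intervalIntegral.integral_interval_sub_left] at H2
    · linarith
    · exact (hc1.mono (by rw [uIcc_of_le ht.1]; exact Icc_subset_Icc_right ht.2)).intervalIntegrable
    · refine (hc1.mono ?_).intervalIntegrable
      rw [uIcc_of_le (by linarith)]; exact Icc_subset_Icc_right (by linarith [ht.2])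
  · intro t ht
    have hm : MapsTo (fun t ↦ t - (1 - δ)) (Icc (1 - δ) 1) (Icc 0 1) := by
      intro u hu
      constructor <;> simp only <;> linarith [hu.1, hu.2]
    have h1 := ((h.delay t ht).const_mul (α * (1 - δ))).sub
      (((hint t ⟨hβ.le.trans ht.1, ht.2⟩).mono (Icc_subset_Icc_left hβ.le)).sub
      ((hint _ (hm ht)).comp t ((hasDerivAt_id t).sub_const (1 - δ)).hasDerivWithinAt hm))
    refine h1.congr_deriv ?_
    field_simp
    ring

theorem intervalIntegrable_of_continuousOn_Icc {f : ℝ → ℝ} {T : ℝ} (hT : T ∈ Icc (0 : ℝ) 1)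
    (hf : ContinuousOn f (Icc 0 1)) : IntervalIntegrable f volume 0 T :=
  (hf.mono (by rw [uIcc_of_le hT.1]; exact Icc_subset_Icc_right hT.2)).intervalIntegrable

/-- A delay solution is below every continuous Volterra supersolution. -/
theorem IsDelaySolution.le_of_supersolution {δ α : ℝ} {φ g : ℝ → ℝ} (hα : 1 < α) (hδ0 : 0 ≤ δ)
    (hδ1 : δ < 1) (h : IsDelaySolution δ α φ) (hg : ContinuousOn g (Icc 0 1))
    (hsup : ∀ t ∈ Icc (0 : ℝ) 1,
      ∫ u in (max (t - (1 - δ)) 0)..t, (g u + 1) ≤ coeff α (1 - δ) t * g t) :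
    ∀ t ∈ Icc (0 : ℝ) 1, φ t ≤ g t := by
  have h1 : (1 : ℝ) ∈ Icc (0 : ℝ) 1 := ⟨zero_le_one, le_rfl⟩
  have hc := h.continuousOn hα hδ0 hδ1
  obtain ⟨M, hM⟩ := (isCompact_Icc.bddAbove_image (hc.sub hg))
  exact volterra_comparison hα (by linarith) (intervalIntegrable_of_continuousOn_Icc h1 hc)
    (intervalIntegrable_of_continuousOn_Icc h1 hg) (fun t ht ↦ hM ⟨t, ht, rfl⟩)
    (fun t ht ↦ (h.volterra hα hδ0 hδ1 ht).le) hsup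

theorem IsDelaySolution.eqOn {δ α : ℝ} {φ ψ : ℝ → ℝ} (hα : 1 < α) (hδ0 : 0 ≤ δ)
    (hδ1 : δ < 1) (hφ : IsDelaySolution δ α φ) (hψ : IsDelaySolution δ α ψ) :
    EqOn ψ φ (Icc 0 1) := fun t ht ↦ le_antisymm
  (hψ.le_of_supersolution hα hδ0 hδ1 (hφ.continuousOn hα hδ0 hδ1)
    (fun _ ht ↦ (hφ.volterra hα hδ0 hδ1 ht).ge) t ht)
  (hφ.le_of_supersolution hα hδ0 hδ1 (hψ.continuousOn hα hδ0 hδ1)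
    (fun _ ht ↦ (hψ.volterra hα hδ0 hδ1 ht).ge) t ht)

/-- One step of the method of steps: the solution on the whole line of
`φ' t = c * (φ t - f (t - β))` to the right of `β` that equals `init` to the left of `β`, by
variation of constants. Clamping `t` at `β` from both sides makes the formula continuous. -/
noncomputable def delayStep (c β : ℝ) (init f : ℝ → ℝ) (t : ℝ) : ℝ :=
  Real.exp (c * (max t β - β)) *
    (init (min t β) - c * ∫ s in β..max t β, Real.exp (-(c * (s - β))) * f (s - β))

theorem delayStep_of_le {c β t : ℝ} {init f : ℝ → ℝ} (ht : t ≤ β) :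
    delayStep c β init f t = init t := by
  simp [delayStep, max_eq_right ht, min_eq_left ht]

theorem delayStep_of_ge {c β t : ℝ} {init f : ℝ → ℝ} (ht : β ≤ t) :
    delayStep c β init f t = Real.exp (c * (t - β)) *
      (init β - c * ∫ s in β..t, Real.exp (-(c * (s - β))) * f (s - β)) := by
  simp [delayStep, max_eq_left ht, min_eq_right ht]

theorem continuous_delayStep {c β : ℝ} {init f : ℝ → ℝ} (hi : Continuous init)
    (hf : Continuous f) : Continuous (delayStep c β init f) := by
  have h : Continuous fun t ↦ ∫ s in β..t, Real.exp (-(c * (s - β))) * f (s - β) :=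
    intervalIntegral.continuous_primitive
      (fun a b ↦ Continuous.intervalIntegrable (by fun_prop) a b) β
  have h' := h.comp (continuous_id.max continuous_const : Continuous fun t : ℝ ↦ max t β)
  simp only [Function.comp_def] at h'
  unfold delayStep
  fun_prop

theorem hasDerivWithinAt_delayStep {c β t : ℝ} {init f : ℝ → ℝ} (hf : Continuous f)
    (ht : β ≤ t) : HasDerivWithinAt (delayStep c β init f)
      (c * (delayStep c β init f t - f (t - β))) (Ici β) t := by
  have hg : Continuous fun s ↦ Real.exp (-(c * (s - β))) * f (s - β) := by fun_prop
  have h1 : HasDerivAt (fun t ↦ Real.exp (c * (t - β))) (Real.exp (c * (t - β)) * (c * 1)) t :=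
    (((hasDerivAt_id t).sub_const β).const_mul c).exp
  have h2 := h1.mul (((hg.integral_hasStrictDerivAt β t).hasDerivAt.const_mul c).const_sub (init β))
  refine (h2.hasDerivWithinAt.congr_deriv ?_).congr (fun u hu ↦ delayStep_of_ge hu)
    (delayStep_of_ge ht)
  rw [delayStep_of_ge ht, Real.exp_neg]
  have := Real.exp_ne_zero (c * (t - β))
  field_simp
  ring

theorem delayStep_congr {c β b t : ℝ} {init f g : ℝ → ℝ} (h : ∀ u ≤ b, f u = g u)
    (ht : t ≤ b + β) : delayStep c β init f t = delayStep c β init g t := by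
  rcases le_total t β with hle | hge
  · rw [delayStep_of_le hle, delayStep_of_le hle]
  · rw [delayStep_of_ge hge, delayStep_of_ge hge]
    congr 3
    refine intervalIntegral.integral_congr fun s hs ↦ ?_
    rw [uIcc_of_le hge] at hs
    rw [h (s - β) (by linarith [hs.2])]

/-- The delay equation has a solution: `n` steps determine it up to time `(n + 1) * (1 - δ)`. -/
theorem exists_isDelaySolution {δ α : ℝ} (hα : 1 < α) (hδ1 : δ < 1) :
    ∃ φ, IsDelaySolution δ α φ := by
  have hβ : 0 < 1 - δ := by linarith
  set β := 1 - δ with hβdef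
  have hb : 0 < (α - 1) * β := mul_pos (by linarith) hβ
  let init : ℝ → ℝ := fun t ↦ Real.log (1 + max t 0 / ((α - 1) * β))
  have hinit : Continuous init := by
    refine Continuous.log (by fun_prop) fun t ↦ ?_
    have : 0 ≤ max t 0 / ((α - 1) * β) := div_nonneg (le_max_right _ _) hb.le
    positivity
  let S := delayStep (1 / (α * β)) β init
  have hcont : ∀ n, Continuous (S^[n] init) := by
    intro n
    induction n with
    | zero => exact hinit
    | succ n ih =>
      rw [Function.iterate_succ_apply']
      exact continuous_delayStep hinit ih
  have hagree : ∀ n : ℕ, ∀ t ≤ (n + 1) * β, (S^[n] init) t = (S^[n + 1] init) t := by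
    intro n
    induction n with
    | zero =>
      intro t ht
      exact (delayStep_of_le (by simpa using ht)).symm
    | succ n ih =>
      intro t ht
      rw [Function.iterate_succ_apply', Function.iterate_succ_apply' _ (n + 1)]
      refine delayStep_congr ih ?_
      push_cast at ht
      linarith
  obtain ⟨N, hN⟩ := exists_nat_gt (1 / β)
  rw [div_lt_iff₀ hβ] at hN
  refine ⟨S^[N + 1] init, ⟨fun t ht ↦ ?_, fun t ht ↦ ?_⟩⟩
  · rw [Function.iterate_succ_apply']
    refine (delayStep_of_le ht.2).trans ?_
    simp only [init, max_eq_left ht.1]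
    rfl
  · rw [← hβdef] at ht ⊢
    rw [← hagree N (t - β) (by linarith [ht.2])]
    simp only [Function.iterate_succ_apply']
    exact (hasDerivWithinAt_delayStep (hcont N) ht.1).mono Icc_subset_Ici_self

theorem IsDelaySolution.strictMonoOn_Icc_of_lt {δ α : ℝ} {φ : ℝ → ℝ} (hα : 1 < α) (hδ0 : 0 ≤ δ)
    (hδ1 : δ < 1) (h : IsDelaySolution δ α φ) {b : ℝ} (hb : b ∈ Icc (1 - δ) 1)
    (hlt : ∀ t ∈ Ioo (1 - δ) b, φ (t - (1 - δ)) < φ t) : StrictMonoOn φ (Icc 0 b) := by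
  have hβ : 0 < 1 - δ := by linarith
  have hc := h.continuousOn hα hδ0 hδ1
  rw [← Icc_union_Icc_eq_Icc hβ.le hb.1]
  refine StrictMonoOn.union (c := 1 - δ) ?_ ?_ (isGreatest_Icc hβ.le) (isLeast_Icc hb.1)
  · refine strictMonoOn_of_hasDerivWithinAt_pos (f' := fun t ↦ 1 / coeff α (1 - δ) t)
      (convex_Icc _ _) (hc.mono (Icc_subset_Icc_right (by linarith))) ?_ ?_
    · intro t ht
      exact (h.hasDerivWithinAt_initial hα hδ1 (interior_subset ht)).mono interior_subset
    · intro t ht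
      exact one_div_pos.2 (coeff_pos hα hβ (interior_subset ht).1)
  · refine strictMonoOn_of_hasDerivWithinAt_pos
      (f' := fun t ↦ 1 / (α * (1 - δ)) * (φ t - φ (t - (1 - δ))))
      (convex_Icc _ _) (hc.mono (Icc_subset_Icc hβ.le hb.2)) ?_ ?_
    · intro t ht
      rw [interior_Icc] at ht
      exact (h.delay t ⟨ht.1.le, ht.2.le.trans hb.2⟩).mono
        (interior_subset.trans (Icc_subset_Icc_right hb.2))
    · intro t ht
      rw [interior_Icc] at ht
      have := hlt t ht
      exact mul_pos (one_div_pos.2 (mul_pos (by linarith) hβ)) (by linarith)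

/-- A delay solution is strictly increasing: up to a first time `t` where `φ t ≤ φ (t - (1 - δ))`,
its derivative is positive, so `φ (t - (1 - δ)) < φ t` after all. -/
theorem IsDelaySolution.strictMonoOn {δ α : ℝ} {φ : ℝ → ℝ} (hα : 1 < α) (hδ0 : 0 ≤ δ)
    (hδ1 : δ < 1) (h : IsDelaySolution δ α φ) : StrictMonoOn φ (Icc 0 1) := by
  have hβ : 0 < 1 - δ := by linarith
  have hc := h.continuousOn hα hδ0 hδ1
  have hc' : ContinuousOn (fun t ↦ φ (t - (1 - δ))) (Icc (1 - δ) 1) :=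
    hc.comp (by fun_prop) fun t ht ↦ ⟨by linarith [ht.1], by linarith [ht.2]⟩
  suffices hlt : ∀ t ∈ Icc (1 - δ) 1, φ (t - (1 - δ)) < φ t from
    h.strictMonoOn_Icc_of_lt hα hδ0 hδ1 ⟨by linarith, le_rfl⟩
      fun t ht ↦ hlt t (Ioo_subset_Icc_self ht)
  by_contra! hne
  have hcomp : IsCompact {t ∈ Icc (1 - δ) 1 | φ t ≤ φ (t - (1 - δ))} :=
    isCompact_Icc.of_isClosed_subset (IsClosed.isClosed_le isClosed_Icc
      (hc.mono (Icc_subset_Icc_left hβ.le)) hc') (sep_subset _ _)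
  obtain ⟨b, ⟨hb, hle⟩, hmin⟩ := hcomp.exists_isLeast hne
  have hmono := h.strictMonoOn_Icc_of_lt hα hδ0 hδ1 hb fun t ht ↦ by
    by_contra! hcon
    exact absurd (hmin ⟨⟨ht.1.le, ht.2.le.trans hb.2⟩, hcon⟩) (not_le.2 ht.2)
  have := hmono (a := b - (1 - δ)) (b := b) ⟨by linarith [hb.1], by linarith⟩
    ⟨by linarith [hb.1], le_rfl⟩ (by linarith)
  linarith

theorem IsDelaySolution.nonneg {δ α : ℝ} {φ : ℝ → ℝ} (hα : 1 < α) (hδ0 : 0 ≤ δ)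
    (hδ1 : δ < 1) (h : IsDelaySolution δ α φ) {t : ℝ} (ht : t ∈ Icc (0 : ℝ) 1) : 0 ≤ φ t := by
  rw [← h.zero hδ1]
  exact (h.strictMonoOn hα hδ0 hδ1).monotoneOn ⟨le_rfl, zero_le_one⟩ ht ht.1

/-! ### Dependence on the competitive ratio -/

theorem IsDelaySolution.antitone_ratio {δ α α' : ℝ} {φ φ' : ℝ → ℝ} (hα : 1 < α) (hle : α ≤ α')
    (hδ0 : 0 ≤ δ) (hδ1 : δ < 1) (h : IsDelaySolution δ α φ) (h' : IsDelaySolution δ α' φ') :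
    ∀ t ∈ Icc (0 : ℝ) 1, φ' t ≤ φ t := by
  refine h'.le_of_supersolution (hα.trans_le hle) hδ0 hδ1 (h.continuousOn hα hδ0 hδ1) ?_
  intro t ht
  rw [← h.volterra hα hδ0 hδ1 ht]
  refine mul_le_mul_of_nonneg_right ?_ (h.nonneg hα hδ0 hδ1 ht)
  exact sub_le_sub_right (mul_le_mul_of_nonneg_right hle (by linarith)) _

theorem IsDelaySolution.volterra_one {δ α : ℝ} {φ : ℝ → ℝ} (hα : 1 < α) (hδ0 : 0 ≤ δ)
    (hδ1 : δ < 1) (h : IsDelaySolution δ α φ) :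
    α * (1 - δ) * φ 1 = ∫ u in δ..1, (φ u + 1) := by
  have := h.volterra hα hδ0 hδ1 (t := 1) ⟨zero_le_one, le_rfl⟩
  rwa [coeff_of_ge (by linarith), sub_sub_cancel, max_eq_left hδ0] at this

theorem IsDelaySolution.apply_one_lt_of_ratio_lt {δ α α' : ℝ} {φ φ' : ℝ → ℝ} (hα : 1 < α)
    (hlt : α < α') (hδ0 : 0 ≤ δ) (hδ1 : δ < 1) (h : IsDelaySolution δ α φ)
    (h' : IsDelaySolution δ α' φ') : φ' 1 < φ 1 := by
  have hα' := hα.trans hlt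
  have hβ : 0 < 1 - δ := by linarith
  have hpos : 0 < φ' 1 := by
    rw [← h'.zero hδ1]
    exact (h'.strictMonoOn hα' hδ0 hδ1) ⟨le_rfl, zero_le_one⟩ ⟨zero_le_one, le_rfl⟩ zero_lt_one
  have hint : ∀ {α : ℝ} {φ : ℝ → ℝ}, 1 < α → IsDelaySolution δ α φ →
      IntervalIntegrable (fun u ↦ φ u + 1) volume δ 1 := fun hα h ↦
    (((h.continuousOn hα hδ0 hδ1).add continuousOn_const).mono
      (by rw [uIcc_of_le hδ1.le]; exact Icc_subset_Icc_left hδ0)).intervalIntegrable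
  have h1 : α' * (1 - δ) * φ' 1 ≤ α * (1 - δ) * φ 1 := by
    rw [h.volterra_one hα hδ0 hδ1, h'.volterra_one hα' hδ0 hδ1]
    refine intervalIntegral.integral_mono_on hδ1.le (hint hα' h') (hint hα h) fun u hu ↦ ?_
    linarith [h.antitone_ratio hα hlt.le hδ0 hδ1 h' u ⟨hδ0.trans hu.1, hu.2⟩]
  have h2 : α * (1 - δ) * φ' 1 < α' * (1 - δ) * φ' 1 :=
    mul_lt_mul_of_pos_right (mul_lt_mul_of_pos_right hlt hβ) hpos
  exact lt_of_mul_lt_mul_left (h2.trans_le h1) (mul_pos (by linarith) hβ).le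

/-- `φ 1` is a Lipschitz function of the ratio: `φ' t + ε * exp (K * t)` is a supersolution for the
smaller ratio `α` when `ε` is a suitable multiple of `α' - α`. -/
theorem IsDelaySolution.le_add_mul_sub {δ α₀ α α' : ℝ} {φ₀ φ φ' : ℝ → ℝ} (hα₀ : 1 < α₀)
    (h₀α : α₀ ≤ α) (hle : α ≤ α') (hδ0 : 0 ≤ δ) (hδ1 : δ < 1) (h₀ : IsDelaySolution δ α₀ φ₀)
    (h : IsDelaySolution δ α φ) (h' : IsDelaySolution δ α' φ') :
    φ 1 ≤ φ' 1 + 2 * φ₀ 1 / (α₀ - 1) * Real.exp (2 / ((α₀ - 1) * (1 - δ))) * (α' - α) := by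
  have hα := hα₀.trans_le h₀α
  have hα' := hα.trans_le hle
  have hβ : 0 < 1 - δ := by linarith
  have hα₁ : 0 < α₀ - 1 := by linarith
  set β := 1 - δ with hβdef
  set b := (α₀ - 1) * β with hb
  have hbpos : 0 < b := mul_pos hα₁ hβ
  set ε := 2 * φ₀ 1 / (α₀ - 1) * (α' - α) with hε
  have h01 : (1 : ℝ) ∈ Icc (0 : ℝ) 1 := ⟨zero_le_one, le_rfl⟩
  have hφ₀ : 0 ≤ φ₀ 1 := h₀.nonneg hα₀ hδ0 hδ1 h01
  have hεpos : 0 ≤ ε := by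
    have := sub_nonneg.2 hle
    positivity
  have hc' := h'.continuousOn hα' hδ0 hδ1
  have := h.le_of_supersolution hα hδ0 hδ1 (g := fun t ↦ φ' t + ε * Real.exp (2 / b * t))
    (hc'.add (by fun_prop)) ?_ 1 h01
  · refine this.trans_eq ?_
    simp only [hε, mul_one]
    ring
  intro t ht
  rw [← hβdef]
  have hmem := max_sub_mem_Icc hβ ht.1
  have hsplit : ∫ u in (max (t - β) 0)..t, (φ' u + ε * Real.exp (2 / b * u) + 1)
      = (∫ u in (max (t - β) 0)..t, (φ' u + 1))
        + ∫ u in (max (t - β) 0)..t, ε * Real.exp (2 / b * u) := by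
    rw [← intervalIntegral.integral_add]
    · refine intervalIntegral.integral_congr fun u _ ↦ ?_
      ring
    · exact (intervalIntegrable_delay hβ (intervalIntegrable_of_continuousOn_Icc h01 hc') ht).add
        intervalIntegrable_const
    · exact Continuous.intervalIntegrable (by fun_prop) _ _
  have hexp : ∫ u in (max (t - β) 0)..t, ε * Real.exp (2 / b * u)
      ≤ ε * Real.exp (2 / b * t) * (b / 2) := by
    rw [intervalIntegral.integral_const_mul, mul_assoc ε]
    refine mul_le_mul_of_nonneg_left ?_ hεpos
    have : ∫ u in (max (t - β) 0)..t, Real.exp (2 / b * u)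
        = (2 / b)⁻¹ * (Real.exp (2 / b * t) - Real.exp (2 / b * max (t - β) 0)) := by
      rw [intervalIntegral.integral_comp_mul_left (fun u ↦ Real.exp u) (by positivity),
        integral_exp, smul_eq_mul]
    rw [this, inv_div, mul_comm]
    exact mul_le_mul_of_nonneg_right (by linarith [Real.exp_pos (2 / b * max (t - β) 0)])
      (by positivity)
  rw [hsplit, ← h'.volterra hα' hδ0 hδ1 ht]
  have hφ' : φ' t ≤ φ₀ 1 :=
    ((h'.strictMonoOn hα' hδ0 hδ1).monotoneOn ht h01 ht.2).trans
      (h₀.antitone_ratio hα₀ (h₀α.trans hle) hδ0 hδ1 h' 1 h01)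
  have hexp1 : 1 ≤ Real.exp (2 / b * t) := Real.one_le_exp (mul_nonneg (by positivity) ht.1)
  have hcoeff : coeff α' β t = coeff α β t + (α' - α) * β := by unfold coeff; ring
  have hb' : b ≤ coeff α β t :=
    (mul_le_mul_of_nonneg_right (by linarith) hβ.le).trans (coeff_ge hβ ht.1)
  have h1 : (α' - α) * β * φ' t ≤ ε * Real.exp (2 / b * t) * (b / 2) := by
    have e : ε * Real.exp (2 / b * t) * (b / 2)
        = (α' - α) * β * (φ₀ 1 * Real.exp (2 / b * t)) := by
      rw [hε, hb]; field_simp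
    rw [e]
    refine mul_le_mul_of_nonneg_left ?_ (mul_nonneg (sub_nonneg.2 hle) hβ.le)
    exact hφ'.trans (le_mul_of_one_le_right hφ₀ hexp1)
  have h2 : b * (ε * Real.exp (2 / b * t)) ≤ coeff α β t * (ε * Real.exp (2 / b * t)) :=
    mul_le_mul_of_nonneg_right hb' (by positivity)
  rw [hcoeff]
  linarith

/-- Existence of the critical ratio, by the intermediate value theorem: for it the delay
solution reaches `1` exactly at time `1`. -/
theorem exists_isDelaySolution_one_eq_one {δ : ℝ} (hδ0 : 0 ≤ δ) (hδ1 : δ < 1) :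
    ∃ α φ, 1 < α ∧ IsDelaySolution δ α φ ∧ φ 1 = 1 := by
  have hβ : 0 < 1 - δ := by linarith
  have h01 : (1 : ℝ) ∈ Icc (0 : ℝ) 1 := ⟨zero_le_one, le_rfl⟩
  choose! Φ hΦ using fun α (hα : 1 < α) ↦ exists_isDelaySolution hα hδ1
  -- the ratio for which the initial segment ends at height `1`
  set α₀ : ℝ := 1 + 1 / (Real.exp 1 - 1) with hα₀
  have he : 2 ≤ Real.exp 1 := by linarith [Real.add_one_le_exp (1 : ℝ)]
  have hα₀1 : 1 < α₀ := by
    have : 0 < 1 / (Real.exp 1 - 1) := one_div_pos.2 (by linarith)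
    linarith
  have hα₀2 : α₀ ≤ 2 := by
    have : 1 / (Real.exp 1 - 1) ≤ 1 := by
      rw [div_le_one (by linarith)]; linarith
    linarith
  have hlow : 1 ≤ Φ α₀ 1 := by
    have h1 : Φ α₀ (1 - δ) = 1 := by
      rw [(hΦ α₀ hα₀1).initial _ ⟨hβ.le, le_rfl⟩]
      have : 1 + (1 - δ) / ((α₀ - 1) * (1 - δ)) = Real.exp 1 := by
        have : Real.exp 1 - 1 ≠ 0 := by linarith
        rw [hα₀]
        field_simp
        ring
      rw [this, Real.log_exp]
    refine h1.ge.trans ?_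
    exact ((hΦ α₀ hα₀1).strictMonoOn hα₀1 hδ0 hδ1).monotoneOn ⟨hβ.le, by linarith⟩ h01
      (by linarith)
  have hhigh : Φ 2 1 ≤ 1 := by
    refine (hΦ 2 one_lt_two).le_of_supersolution one_lt_two hδ0 hδ1 (g := fun _ ↦ 1)
      continuousOn_const ?_ 1 h01
    intro t ht
    rw [intervalIntegral.integral_const, smul_eq_mul, coeff]
    rcases le_total t (1 - δ) with hle | hge
    · rw [max_eq_right (by linarith), max_eq_left (by linarith)]; linarith
    · rw [max_eq_left (by linarith), max_eq_right (by linarith)]; linarith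
  have hcont : ContinuousOn (fun α ↦ Φ α 1) (Icc α₀ 2) := by
    set C := 2 * Φ α₀ 1 / (α₀ - 1) * Real.exp (2 / ((α₀ - 1) * (1 - δ))) with hC
    have hC0 : 0 ≤ C := by
      have := sub_pos.2 hα₀1
      positivity
    refine (LipschitzOnWith.of_le_add_mul (K := ⟨C, hC0⟩) ?_).continuousOn
    intro α hα α' hα'
    rcases le_total α α' with hle | hle
    · have := (hΦ α₀ hα₀1).le_add_mul_sub hα₀1 hα.1 hle hδ0 hδ1 (hΦ α (hα₀1.trans_le hα.1))
        (hΦ α' (hα₀1.trans_le hα'.1))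
      rwa [Real.dist_eq, abs_sub_comm, abs_of_nonneg (sub_nonneg.2 hle)]
    · refine ((hΦ α' (hα₀1.trans_le hα'.1)).antitone_ratio (hα₀1.trans_le hα'.1) hle hδ0 hδ1
        (hΦ α (hα₀1.trans_le hα.1)) 1 h01).trans ?_
      exact le_add_of_nonneg_right (mul_nonneg hC0 dist_nonneg)
  obtain ⟨α, hα, hα1⟩ := intermediate_value_Icc' hα₀2 hcont ⟨hhigh, hlow⟩
  exact ⟨α, Φ α, hα₀1.trans_le hα.1, hΦ α (hα₀1.trans_le hα.1), hα1⟩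

/-! ### Quantile functions -/

/-- The law of `g U`, where `U` is uniformly distributed on `(0, 1)`. -/
noncomputable def uniformLaw (g : ℝ → ℝ) : Measure ℝ := (volume.restrict (Ioo 0 1)).map g

/-- The left-continuous quantile function of a distribution on `ℝ`. At `p = 0` it takes the junk
value `sInf univ = 0`. -/
noncomputable def quantile (μ : Measure ℝ) (p : ℝ) : ℝ := sInf {x | p ≤ ProbabilityTheory.cdf μ x}

theorem quantile_zero (μ : Measure ℝ) : quantile μ 0 = 0 := by
  have : {x | 0 ≤ ProbabilityTheory.cdf μ x} = univ :=
    eq_univ_of_forall fun x ↦ ProbabilityTheory.cdf_nonneg μ x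
  rw [quantile, this, Real.sInf_univ]

theorem quantile_le_iff {μ : Measure ℝ} {p x : ℝ} (hp : p ∈ Ioo (0 : ℝ) 1) :
    quantile μ p ≤ x ↔ p ≤ ProbabilityTheory.cdf μ x := by
  have hne : {x | p ≤ ProbabilityTheory.cdf μ x}.Nonempty :=
    (((ProbabilityTheory.tendsto_cdf_atTop μ).eventually (lt_mem_nhds hp.2)).exists).imp
      fun _ h ↦ h.le
  have hbdd : BddBelow {x | p ≤ ProbabilityTheory.cdf μ x} := by
    obtain ⟨y, hy⟩ := ((ProbabilityTheory.tendsto_cdf_atBot μ).eventually (gt_mem_nhds hp.1)).exists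
    refine ⟨y, fun x hx ↦ ?_⟩
    by_contra! hlt
    exact absurd (ProbabilityTheory.monotone_cdf μ hlt.le) (not_le.2 (hy.trans_le hx))
  refine ⟨fun h ↦ ?_, fun h ↦ csInf_le hbdd h⟩
  refine le_trans ?_ (ProbabilityTheory.monotone_cdf μ h)
  refine ge_of_tendsto
    (((ProbabilityTheory.cdf μ).right_continuous (quantile μ p)).mono_left
      (nhdsWithin_mono _ Ioi_subset_Ici_self)) ?_
  filter_upwards [self_mem_nhdsWithin] with y hy
  obtain ⟨z, hz, hzy⟩ := exists_lt_of_csInf_lt hne hy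
  exact le_trans hz (ProbabilityTheory.monotone_cdf μ hzy.le)

theorem volume_Ioo_inter_Iic {c : ℝ} (hc : c ≤ 1) :
    volume (Ioo (0 : ℝ) 1 ∩ Iic c) = ENNReal.ofReal c := by
  have h1 : Ioo (0 : ℝ) 1 ∩ Iic c ⊆ Ioc 0 c := fun u hu ↦ ⟨hu.1.1, hu.2⟩
  have h2 : Ioo 0 c ⊆ Ioo (0 : ℝ) 1 ∩ Iic c := fun u hu ↦ ⟨⟨hu.1, hu.2.trans_le hc⟩, hu.2.le⟩
  refine le_antisymm ((measure_mono h1).trans_eq ?_) (le_trans (Eq.le ?_) (measure_mono h2)) <;>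
    simp

theorem quantile_nonneg {μ : Measure ℝ} [IsProbabilityMeasure μ] (hμ : ∀ᵐ x ∂μ, 0 ≤ x) {p : ℝ}
    (hp : p ∈ Ioo (0 : ℝ) 1) : 0 ≤ quantile μ p := by
  by_contra! hneg
  have h := (quantile_le_iff hp).1 (le_refl (quantile μ p))
  have h0 : μ.real (Iic (quantile μ p)) = 0 := by
    rw [measureReal_eq_zero_iff]
    exact measure_mono_null (fun x hx ↦ not_le.2 (lt_of_le_of_lt hx hneg)) hμ
  rw [ProbabilityTheory.cdf_eq_real, h0] at h
  exact absurd hp.1 (not_lt.2 h)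

theorem monotoneOn_quantile {μ : Measure ℝ} [IsProbabilityMeasure μ] (hμ : ∀ᵐ x ∂μ, 0 ≤ x) :
    MonotoneOn (quantile μ) (Ico 0 1) := by
  intro p hp q hq hpq
  rcases hp.1.eq_or_lt with rfl | hp0
  · rw [quantile_zero]
    rcases hq.1.eq_or_lt with rfl | hq0
    · rw [quantile_zero]
    · exact quantile_nonneg hμ ⟨hq0, hq.2⟩
  · rw [quantile_le_iff ⟨hp0, hp.2⟩]
    exact hpq.trans ((quantile_le_iff ⟨hp0.trans_le hpq, hq.2⟩).1 le_rfl)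

theorem aemeasurable_of_monotoneOn_Ico {g : ℝ → ℝ} (hg : MonotoneOn g (Ico 0 1)) :
    AEMeasurable g (volume.restrict (Ioo 0 1)) :=
  aemeasurable_restrict_of_monotoneOn measurableSet_Ioo (hg.mono Ioo_subset_Ico_self)

theorem isProbabilityMeasure_uniformLaw {g : ℝ → ℝ} (hg : MonotoneOn g (Ico 0 1)) :
    IsProbabilityMeasure (uniformLaw g) := by
  have : IsProbabilityMeasure (volume.restrict (Ioo (0 : ℝ) 1)) := ⟨by simp⟩
  exact Measure.isProbabilityMeasure_map (aemeasurable_of_monotoneOn_Ico hg)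

theorem uniformLaw_Iic {g : ℝ → ℝ} (hg : MonotoneOn g (Ico 0 1)) {x c : ℝ} (hc : c ≤ 1)
    (h : ∀ u ∈ Ioo (0 : ℝ) 1, g u ≤ x ↔ u ≤ c) : uniformLaw g (Iic x) = ENNReal.ofReal c := by
  rw [uniformLaw, Measure.map_apply_of_aemeasurable (aemeasurable_of_monotoneOn_Ico hg)
    measurableSet_Iic, Measure.restrict_apply' measurableSet_Ioo, ← volume_Ioo_inter_Iic hc,
    inter_comm]
  congr 1
  ext u
  exact and_congr_right fun hu ↦ h u hu

theorem uniformLaw_quantile {μ : Measure ℝ} (hμ : IsStrategy μ) : uniformLaw (quantile μ) = μ := by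
  have := hμ.1
  have hmono := monotoneOn_quantile hμ.2
  have := isProbabilityMeasure_uniformLaw hmono
  refine Measure.ext_of_Iic _ _ fun x ↦ ?_
  rw [uniformLaw_Iic hmono (ProbabilityTheory.cdf_le_one μ x) fun u hu ↦ quantile_le_iff hu,
    ProbabilityTheory.ofReal_cdf]

theorem isStrategy_uniformLaw {g : ℝ → ℝ} (hg : MonotoneOn g (Ico 0 1)) (h0 : 0 ≤ g 0) :
    IsStrategy (uniformLaw g) := by
  refine ⟨isProbabilityMeasure_uniformLaw hg, ?_⟩
  rw [uniformLaw, ae_map_iff (aemeasurable_of_monotoneOn_Ico hg) measurableSet_Ici]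
  filter_upwards [ae_restrict_mem measurableSet_Ioo] with u hu
  exact h0.trans (hg ⟨le_rfl, zero_lt_one⟩ ⟨hu.1.le, hu.2⟩ hu.1.le)

/-! ### The conditional value-at-risk of a strategy -/

theorem measurable_cost (s : ℝ) : Measurable (cost s) :=
  Measurable.ite measurableSet_Ioi measurable_const (by fun_prop)

theorem cost_nonneg {s x : ℝ} (hs : 0 < s) (hx : 0 ≤ x) : 0 ≤ cost s x := by
  unfold cost; split_ifs <;> linarith

theorem cost_le {s x : ℝ} : cost s x ≤ s + 1 := by
  unfold cost; split_ifs <;> linarith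

theorem min_le_cost {s x : ℝ} (hx : 0 ≤ x) : min s 1 ≤ cost s x := by
  unfold cost
  split_ifs
  · exact min_le_left _ _
  · exact (min_le_right _ _).trans (by linarith)

theorem nonneg_of_monotoneOn_Ico {g : ℝ → ℝ} (hg : MonotoneOn g (Ico 0 1)) (h0 : 0 ≤ g 0) {u : ℝ}
    (hu : u ∈ Ico (0 : ℝ) 1) : 0 ≤ g u :=
  h0.trans (hg ⟨le_rfl, zero_lt_one⟩ hu hu.1)

theorem intervalIntegrable_cost {g : ℝ → ℝ} (hg : MonotoneOn g (Ico 0 1)) (h0 : 0 ≤ g 0) {s : ℝ}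
    (hs : 0 < s) : IntervalIntegrable (fun u ↦ cost s (g u)) volume 0 1 := by
  rw [intervalIntegrable_iff_integrableOn_Ioo_of_le zero_le_one]
  refine Integrable.of_bound ((measurable_cost s).comp_aemeasurable
    (aemeasurable_of_monotoneOn_Ico hg)).aestronglyMeasurable (s + 1) ?_
  filter_upwards [ae_restrict_mem measurableSet_Ioo] with u hu
  rw [Real.norm_of_nonneg (cost_nonneg hs (nonneg_of_monotoneOn_Ico hg h0 ⟨hu.1.le, hu.2⟩))]
  exact cost_le

theorem cvar_uniformLaw {δ : ℝ} {g : ℝ → ℝ} (hg : MonotoneOn g (Ico 0 1)) (s : ℝ) :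
    cvar δ (uniformLaw g) (cost s)
      = ⨅ τ : ℝ, τ + (1 - δ)⁻¹ * ∫ u in (0 : ℝ)..1, max (cost s (g u) - τ) 0 := by
  unfold cvar
  congr 1
  ext τ
  have hm : Measurable fun x ↦ max (cost s x - τ) 0 :=
    ((measurable_cost s).sub_const τ).max measurable_const
  rw [uniformLaw, integral_map (aemeasurable_of_monotoneOn_Ico hg) hm.aestronglyMeasurable,
    intervalIntegral.integral_of_le zero_le_one, integral_Ioc_eq_integral_Ioo]

/-- The average of the cost over any event of probability `1 - δ` is a lower bound in the infimum
that defines `CVaR_δ`. -/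
theorem integral_cost_le {δ : ℝ} (hδ1 : δ < 1) {g : ℝ → ℝ} (hg : MonotoneOn g (Ico 0 1))
    (h0 : 0 ≤ g 0) {s a : ℝ} (hs : 0 < s) (ha0 : 0 ≤ a) (ha : a ≤ δ) (τ : ℝ) :
    (1 - δ)⁻¹ * ∫ u in a..(a + (1 - δ)), cost s (g u)
      ≤ τ + (1 - δ)⁻¹ * ∫ u in (0 : ℝ)..1, max (cost s (g u) - τ) 0 := by
  have hβ : 0 < 1 - δ := by linarith
  have hint := intervalIntegrable_cost hg h0 hs
  have hsub : IntervalIntegrable (fun u ↦ cost s (g u)) volume a (a + (1 - δ)) :=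
    hint.mono_set (uIcc_subset_Icc_of_mem ⟨ha0, by linarith⟩ ⟨by linarith, by linarith⟩)
  have hd := hint.sub (intervalIntegrable_const (c := τ))
  have hmax : IntervalIntegrable (fun u ↦ max (cost s (g u) - τ) 0) volume 0 1 :=
    ⟨hd.1.pos_part, hd.2.pos_part⟩
  have h1 : ∫ u in a..(a + (1 - δ)), (cost s (g u) - τ)
      ≤ ∫ u in a..(a + (1 - δ)), max (cost s (g u) - τ) 0 :=
    intervalIntegral.integral_mono_on (by linarith) (hsub.sub intervalIntegrable_const)
      (hmax.mono_set (uIcc_subset_Icc_of_mem ⟨ha0, by linarith⟩ ⟨by linarith, by linarith⟩))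
      fun u _ ↦ le_max_left _ _
  have h2 : ∫ u in a..(a + (1 - δ)), max (cost s (g u) - τ) 0
      ≤ ∫ u in (0 : ℝ)..1, max (cost s (g u) - τ) 0 :=
    intervalIntegral.integral_mono_interval ha0 (by linarith) (by linarith)
      (Filter.Eventually.of_forall fun u ↦ le_max_right _ _) hmax
  rw [intervalIntegral.integral_sub hsub intervalIntegrable_const,
    intervalIntegral.integral_const, smul_eq_mul, add_sub_cancel_left] at h1
  rw [inv_mul_eq_div, inv_mul_eq_div, div_le_iff₀ hβ, add_mul, div_mul_cancel₀ _ hβ.ne']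
  linarith

theorem integral_cost_le_cvar {δ : ℝ} (hδ1 : δ < 1) {g : ℝ → ℝ}
    (hg : MonotoneOn g (Ico 0 1)) (h0 : 0 ≤ g 0) {s a : ℝ} (hs : 0 < s) (ha0 : 0 ≤ a)
    (ha : a ≤ δ) :
    ∫ u in a..(a + (1 - δ)), cost s (g u) ≤ (1 - δ) * cvar δ (uniformLaw g) (cost s) := by
  rw [← inv_mul_le_iff₀ (by linarith), cvar_uniformLaw hg]
  exact le_ciInf fun τ ↦ integral_cost_le hδ1 hg h0 hs ha0 ha τ

theorem cvar_le {δ : ℝ} (hδ0 : 0 ≤ δ) (hδ1 : δ < 1) {g : ℝ → ℝ}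
    (hg : MonotoneOn g (Ico 0 1)) (h0 : 0 ≤ g 0) {s : ℝ} (hs : 0 < s) (τ : ℝ) :
    cvar δ (uniformLaw g) (cost s)
      ≤ τ + (1 - δ)⁻¹ * ∫ u in (0 : ℝ)..1, max (cost s (g u) - τ) 0 := by
  rw [cvar_uniformLaw hg]
  refine ciInf_le ⟨(1 - δ)⁻¹ * ∫ u in (0 : ℝ)..(0 + (1 - δ)), cost s (g u), ?_⟩ τ
  rintro _ ⟨τ', rfl⟩
  exact integral_cost_le hδ1 hg h0 hs le_rfl hδ0 τ'

theorem compRatio_le_iff {δ α : ℝ} {μ : Measure ℝ} :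
    compRatio δ μ ≤ α ↔ ∀ s, 0 < s → cvar δ μ (cost s) ≤ α * min s 1 := by
  simp only [compRatio, iSup_le_iff, mem_Ioi, EReal.coe_le_coe_iff, ratio]
  refine forall₂_congr fun s hs ↦ ?_
  rw [div_le_iff₀ (lt_min hs zero_lt_one)]

/-! ### Lower bound on the competitive ratio -/

/-- The quantile function `g` of a strategy, capped at `1`. The value at `t = 1` is set to `1`,
which keeps the function monotone. -/
noncomputable def cap (g : ℝ → ℝ) (t : ℝ) : ℝ := if t < 1 then min (g t) 1 else 1

theorem cap_le_one {g : ℝ → ℝ} {t : ℝ} : cap g t ≤ 1 := by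
  unfold cap; split_ifs
  · exact min_le_right _ _
  · exact le_rfl

theorem cap_one {g : ℝ → ℝ} : cap g 1 = 1 := by simp [cap]

theorem monotoneOn_cap {g : ℝ → ℝ} (hg : MonotoneOn g (Ico 0 1)) :
    MonotoneOn (cap g) (Icc 0 1) := by
  intro x hx y hy hxy
  by_cases h : y < 1
  · rw [cap, cap, if_pos h, if_pos (hxy.trans_lt h)]
    exact min_le_min_right 1 (hg ⟨hx.1, hxy.trans_lt h⟩ ⟨hy.1, h⟩ hxy)
  · rw [cap.eq_def g y, if_neg h]
    exact cap_le_one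

theorem cap_nonneg {g : ℝ → ℝ} (hg : MonotoneOn g (Ico 0 1)) (h0 : 0 ≤ g 0) {t : ℝ} (ht : 0 ≤ t) :
    0 ≤ cap g t := by
  unfold cap; split_ifs with h
  · exact le_min (nonneg_of_monotoneOn_Ico hg h0 ⟨ht, h⟩) zero_le_one
  · exact zero_le_one

theorem intervalIntegrable_of_monotoneOn_Icc {f : ℝ → ℝ} (hf : MonotoneOn f (Icc 0 1)) :
    IntervalIntegrable f volume 0 1 :=
  MonotoneOn.intervalIntegrable (by rwa [uIcc_of_le zero_le_one])

/-- The capped quantile function of a strategy of competitive ratio at most `α` is a supersolution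
of the Volterra equation. For `t < 1` this is the bound for seasons whose length decreases to
`g t`; for `t = 1` a season of length `2` is enough. -/
theorem cap_supersolution {δ α : ℝ} (hδ0 : 0 ≤ δ) (hδ1 : δ < 1) {g : ℝ → ℝ}
    (hg : MonotoneOn g (Ico 0 1)) (h0 : 0 ≤ g 0)
    (h : compRatio δ (uniformLaw g) ≤ α) {t : ℝ} (ht : t ∈ Icc (0 : ℝ) 1) :
    ∫ u in (max (t - (1 - δ)) 0)..t, (cap g u + 1) ≤ coeff α (1 - δ) t * cap g t := by
  have hβ : 0 < 1 - δ := by linarith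
  have hcap := intervalIntegrable_of_monotoneOn_Icc (monotoneOn_cap hg)
  rw [compRatio_le_iff] at h
  have hmem := max_sub_mem_Icc hβ ht.1
  have haδ : max (t - (1 - δ)) 0 ≤ δ := max_le (by linarith [ht.2]) hδ0
  set a := max (t - (1 - δ)) 0 with ha
  have hI : IntervalIntegrable (fun u ↦ cap g u + 1) volume a t :=
    (intervalIntegrable_delay hβ hcap ht).add intervalIntegrable_const
  have hcost : ∀ s, 0 < s → ∫ u in a..(a + (1 - δ)), cost s (g u) ≤ α * (1 - δ) * min s 1 := by
    intro s hs
    refine (integral_cost_le_cvar hδ1 hg h0 hs hmem.1 haδ).trans ?_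
    calc _ ≤ (1 - δ) * (α * min s 1) := mul_le_mul_of_nonneg_left (h s hs) hβ.le
      _ = _ := by ring
  have hsub : ∀ s, 0 < s → ∀ b ∈ Icc (0 : ℝ) 1, ∀ c ∈ Icc (0 : ℝ) 1,
      IntervalIntegrable (fun u ↦ cost s (g u)) volume b c := fun s hs b hb c hc ↦
    (intervalIntegrable_cost hg h0 hs).mono_set (uIcc_subset_Icc_of_mem hb hc)
  have hae : a + (1 - δ) = t + max (1 - δ - t) 0 := by
    rcases le_total t (1 - δ) with hle | hge
    · rw [ha, max_eq_right (by linarith), max_eq_left (by linarith)]; ring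
    · rw [ha, max_eq_left (by linarith), max_eq_right (by linarith)]; ring
  have haI : a ∈ Icc (0 : ℝ) 1 := ⟨hmem.1, hmem.2.trans ht.2⟩
  have heI : a + (1 - δ) ∈ Icc (0 : ℝ) 1 := ⟨by linarith [hmem.1], by linarith⟩
  have hte : t ≤ a + (1 - δ) := by rw [hae]; linarith [le_max_right (1 - δ - t) 0]
  rcases ht.2.eq_or_lt with rfl | ht1
  · have h2 := hcost 2 two_pos
    have e : a + (1 - δ) = 1 := by
      rw [hae, max_eq_right (by linarith), add_zero]
    rw [e, min_eq_right one_le_two, mul_one] at h2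
    rw [cap_one, mul_one, coeff_of_ge (by linarith)]
    refine le_trans (intervalIntegral.integral_mono_on_of_le_Ioo hmem.2 hI
      (hsub 2 two_pos a haI 1 ht) fun u hu ↦ ?_) h2
    rw [cap, if_pos hu.2, cost]
    split_ifs
    · linarith [min_le_right (g u) 1]
    · linarith [min_le_left (g u) 1]
  have key : ∀ s, g t < s → ∫ u in a..t, (cap g u + 1) ≤ coeff α (1 - δ) t * min s 1 := by
    intro s hgs
    have hs : 0 < s := (nonneg_of_monotoneOn_Ico hg h0 ⟨ht.1, ht1⟩).trans_lt hgs
    have h1 : ∫ u in a..t, (cap g u + 1) ≤ ∫ u in a..t, cost s (g u) := by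
      refine intervalIntegral.integral_mono_on_of_le_Ioo hmem.2 hI (hsub s hs a haI t ht)
        fun u hu ↦ ?_
      have hu1 : u < 1 := hu.2.trans ht1
      have : g u ≤ g t := hg ⟨hmem.1.trans hu.1.le, hu1⟩ ⟨ht.1, ht1⟩ hu.2.le
      rw [cap, if_pos hu1, cost, if_neg (by linarith)]
      linarith [min_le_left (g u) 1]
    have h2 : max (1 - δ - t) 0 * min s 1 ≤ ∫ u in t..(a + (1 - δ)), cost s (g u) := by
      have : ∫ _ in t..(a + (1 - δ)), min s 1 = max (1 - δ - t) 0 * min s 1 := by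
        rw [intervalIntegral.integral_const, smul_eq_mul, hae, add_sub_cancel_left]
      rw [← this]
      refine intervalIntegral.integral_mono_on_of_le_Ioo hte intervalIntegrable_const
        (hsub s hs t ht _ heI) fun u hu ↦ ?_
      exact min_le_cost (nonneg_of_monotoneOn_Ico hg h0
        ⟨ht.1.trans hu.1.le, hu.2.trans_le heI.2⟩)
    have h3 := intervalIntegral.integral_add_adjacent_intervals (hsub s hs a haI t ht)
      (hsub s hs t ht _ heI)
    have h4 := hcost s hs
    unfold coeff
    linarith
  rw [cap.eq_def g t, if_pos ht1]
  have hlim : Filter.Tendsto (fun s ↦ coeff α (1 - δ) t * min s 1) (nhdsWithin (g t) (Ioi (g t)))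
      (nhds (coeff α (1 - δ) t * min (g t) 1)) :=
    (Continuous.tendsto (by fun_prop) (g t)).mono_left nhdsWithin_le_nhds
  refine ge_of_tendsto hlim ?_
  filter_upwards [self_mem_nhdsWithin] with s hs
  exact key s hs

theorem IsDelaySolution.le_cap {δ α : ℝ} (hδ0 : 0 ≤ δ) (hδ1 : δ < 1) {g φ : ℝ → ℝ}
    (hg : MonotoneOn g (Ico 0 1)) (h0 : 0 ≤ g 0) (hα : 1 < α)
    (h : compRatio δ (uniformLaw g) ≤ α) (hφ : IsDelaySolution δ α φ) :
    ∀ t ∈ Icc (0 : ℝ) 1, φ t ≤ cap g t := by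
  have hc := hφ.continuousOn hα hδ0 hδ1
  refine volterra_comparison (M := φ 1) hα (by linarith : 0 < 1 - δ)
    (intervalIntegrable_of_continuousOn_Icc ⟨zero_le_one, le_rfl⟩ hc)
    (intervalIntegrable_of_monotoneOn_Icc (monotoneOn_cap hg)) ?_
    (fun t ht ↦ (hφ.volterra hα hδ0 hδ1 ht).le)
    (fun t ht ↦ cap_supersolution hδ0 hδ1 hg h0 h ht)
  intro t ht
  have := (hφ.strictMonoOn hα hδ0 hδ1).monotoneOn ht ⟨zero_le_one, le_rfl⟩ ht.2
  linarith [cap_nonneg hg h0 ht.1]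

/-- No strategy beats the critical ratio. -/
theorem le_compRatio {δ α : ℝ} (hδ0 : 0 ≤ δ) (hδ1 : δ < 1) (hα : 1 < α) {φ : ℝ → ℝ}
    (hφ : IsDelaySolution δ α φ)
    (hφ1 : φ 1 = 1) {ν : Measure ℝ} (hν : IsStrategy ν) : (α : EReal) ≤ compRatio δ ν := by
  by_contra! hlt
  obtain ⟨α', h1, h2⟩ := EReal.lt_iff_exists_real_btwn.1
    (max_lt hlt (by exact_mod_cast hα : ((1 : ℝ) : EReal) < α))
  have hα' : 1 < α' := by exact_mod_cast (le_max_right _ _).trans_lt h1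
  obtain ⟨φ', hφ'⟩ := exists_isDelaySolution hα' hδ1
  have := hν.1
  have hle : φ' 1 ≤ cap (quantile ν) 1 :=
    hφ'.le_cap hδ0 hδ1 (monotoneOn_quantile hν.2) (quantile_zero ν).ge hα'
      (by rw [uniformLaw_quantile hν]; exact ((le_max_left _ _).trans_lt h1).le) 1
      ⟨zero_le_one, le_rfl⟩
  have := hφ'.apply_one_lt_of_ratio_lt hα' (by exact_mod_cast h2) hδ0 hδ1 hφ
  rw [cap_one] at hle
  linarith

/-! ### Uniqueness of the optimal strategy -/

/-- A monotone supersolution that touches a continuous solution at `1` is equal to it: contact at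
`t` forces contact on `[(t - β)⁺, t]`, and contact spreads backwards from `1` to `0`. -/
theorem eqOn_of_supersolution_of_eq_one {φ ψ : ℝ → ℝ} {α β : ℝ} (hβ : 0 < β)
    (hφ : ContinuousOn φ (Icc 0 1)) (hψ : MonotoneOn ψ (Icc 0 1))
    (hle : ∀ t ∈ Icc (0 : ℝ) 1, φ t ≤ ψ t)
    (hsol : ∀ t ∈ Icc (0 : ℝ) 1, coeff α β t * φ t = ∫ u in (max (t - β) 0)..t, (φ u + 1))
    (hsup : ∀ t ∈ Icc (0 : ℝ) 1, ∫ u in (max (t - β) 0)..t, (ψ u + 1) ≤ coeff α β t * ψ t)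
    (h1 : ψ 1 = φ 1) : EqOn ψ φ (Icc 0 1) := by
  have hφi := intervalIntegrable_of_continuousOn_Icc ⟨zero_le_one, le_rfl⟩ hφ
  have hψi := intervalIntegrable_of_monotoneOn_Icc hψ
  have step : ∀ t ∈ Icc (0 : ℝ) 1, ψ t = φ t → ∀ x ∈ Ico (max (t - β) 0) t, ψ x = φ x := by
    intro t ht htt x hx
    have hx0 : 0 ≤ x := (le_max_right _ _).trans hx.1
    by_contra hne
    have hxI : x ∈ Icc (0 : ℝ) 1 := ⟨hx0, hx.2.le.trans ht.2⟩
    have hlt : φ x < ψ x := lt_of_le_of_ne (hle x hxI) (Ne.symm hne)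
    -- the gap persists on a right neighbourhood of `x`
    obtain ⟨y, hxy, hyt, hy⟩ : ∃ y, x < y ∧ y ≤ t ∧ ∀ u ∈ Ioo x y, φ u < ψ x := by
      have hev : ∀ᶠ u in nhdsWithin x (Ioi x), φ u < ψ x := by
        have : nhdsWithin x (Ioi x) ≤ nhdsWithin x (Icc 0 1) := by
          refine nhdsWithin_le_of_mem ?_
          exact Filter.mem_of_superset (Ioo_mem_nhdsGT (hx.2.trans_le ht.2)) fun u hu ↦
            ⟨hx0.trans hu.1.le, hu.2.le⟩
        exact this ((hφ x hxI).eventually_lt_const hlt)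
      obtain ⟨y, hy, hsub⟩ := (mem_nhdsGT_iff_exists_Ioo_subset' hx.2).1 hev
      exact ⟨min y t, lt_min hy hx.2, min_le_right _ _,
        fun u hu ↦ hsub ⟨hu.1, hu.2.trans_le (min_le_left _ _)⟩⟩
    have hd : IntervalIntegrable (fun u ↦ ψ u - φ u) volume (max (t - β) 0) t :=
      intervalIntegrable_delay hβ (hψi.sub hφi) ht
    have hzero : ∫ u in (max (t - β) 0)..t, (ψ u - φ u) ≤ 0 := by
      have e : ∫ u in (max (t - β) 0)..t, (ψ u - φ u)
          = (∫ u in (max (t - β) 0)..t, (ψ u + 1)) - ∫ u in (max (t - β) 0)..t, (φ u + 1) := by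
        rw [← intervalIntegral.integral_sub
          ((intervalIntegrable_delay hβ hψi ht).add intervalIntegrable_const)
          ((intervalIntegrable_delay hβ hφi ht).add intervalIntegrable_const)]
        simp
      have := hsup t ht
      rw [htt, hsol t ht] at this
      rw [e]
      linarith
    have hle' : ∫ u in x..y, (ψ u - φ u) ≤ ∫ u in (max (t - β) 0)..t, (ψ u - φ u) := by
      refine intervalIntegral.integral_mono_interval hx.1 hxy.le hyt ?_ hd
      filter_upwards [ae_restrict_mem measurableSet_Ioc] with u hu
      exact sub_nonneg.2 (hle u ⟨(le_max_right _ _).trans hu.1.le, hu.2.trans ht.2⟩)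
    have hpos : 0 < ∫ u in x..y, (ψ u - φ u) := by
      refine intervalIntegral.intervalIntegral_pos_of_pos_on ?_ (fun u hu ↦ ?_) hxy
      · exact (hψi.sub hφi).mono_set (uIcc_subset_Icc_of_mem hxI
          ⟨hx0.trans hxy.le, hyt.trans ht.2⟩)
      · have := hψ hxI ⟨hx0.trans hu.1.le, (hu.2.le.trans hyt).trans ht.2⟩ hu.1.le
        linarith [hy u hu]
    linarith
  have back : ∀ n : ℕ, ∀ x ∈ Icc (max (1 - n * β) 0) 1, ψ x = φ x := by
    intro n
    induction n with
    | zero =>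
      intro x hx
      have : x = 1 := le_antisymm hx.2 (by simpa using hx.1)
      rw [this, h1]
    | succ n ih =>
      intro x hx
      rcases le_or_gt (max (1 - n * β) 0) x with hge | hlt
      · exact ih x ⟨hge, hx.2⟩
      have hn : (0 : ℝ) ≤ n * β := by positivity
      have htI : max (1 - n * β) 0 ∈ Icc (0 : ℝ) 1 :=
        ⟨le_max_right _ _, max_le (by linarith) zero_le_one⟩
      refine step _ htI (ih _ ⟨le_rfl, htI.2⟩) x ⟨?_, hlt⟩
      have hx0 : 0 ≤ x := (le_max_right _ _).trans hx.1
      have hx1 := (le_max_left _ _).trans hx.1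
      push_cast at hx1
      refine max_le ?_ hx0
      rcases max_choice (1 - n * β) 0 with h | h <;> rw [h] at hlt ⊢ <;> linarith
  obtain ⟨N, hN⟩ := exists_nat_gt (1 / β)
  rw [div_lt_iff₀ hβ] at hN
  intro x hx
  exact back N x ⟨by rw [max_eq_right (by linarith)]; exact hx.1, hx.2⟩

theorem IsDelaySolution.uniformLaw_eq_of_compRatio_le {δ α : ℝ} (hδ0 : 0 ≤ δ) (hδ1 : δ < 1)
    (hα : 1 < α) {φ : ℝ → ℝ} (hφ : IsDelaySolution δ α φ) (hφ1 : φ 1 = 1) {ν : Measure ℝ}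
    (hν : IsStrategy ν) (h : compRatio δ ν ≤ α) : ν = uniformLaw φ := by
  have := hν.1
  have hg := monotoneOn_quantile hν.2
  have h0 := (quantile_zero ν).ge
  rw [← uniformLaw_quantile hν] at h
  have heq : EqOn (cap (quantile ν)) φ (Icc 0 1) :=
    eqOn_of_supersolution_of_eq_one (by linarith : 0 < 1 - δ) (hφ.continuousOn hα hδ0 hδ1)
      (monotoneOn_cap hg) (hφ.le_cap hδ0 hδ1 hg h0 hα h)
      (fun t ht ↦ hφ.volterra hα hδ0 hδ1 ht)
      (fun t ht ↦ cap_supersolution hδ0 hδ1 hg h0 h ht) (by rw [cap_one, hφ1])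
  rw [← uniformLaw_quantile hν]
  refine Measure.map_congr ?_
  filter_upwards [ae_restrict_mem measurableSet_Ioo] with u hu
  have h1 := heq (Ioo_subset_Icc_self hu)
  have h2 : φ u < 1 := by
    rw [← hφ1]
    exact hφ.strictMonoOn hα hδ0 hδ1 (Ioo_subset_Icc_self hu) ⟨zero_le_one, le_rfl⟩ hu.2
  rw [cap, if_pos hu.2] at h1
  rcases min_choice (quantile ν u) 1 with h3 | h3 <;> rw [h3] at h1
  · exact h1
  · linarith

/-! ### The optimal strategy -/

/-- The strategy with inverse CDF `φ` attains the ratio `α`. With `φ p = min s 1`, the worst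
`1 - δ` fraction of the costs is `φ u + 1` for `u` in `[(p - (1 - δ))⁺, p]`, filled up with copies
of `min s 1` when `p < 1 - δ`. -/
theorem IsDelaySolution.compRatio_uniformLaw_le {δ α : ℝ} (hδ0 : 0 ≤ δ) (hδ1 : δ < 1)
    (hα : 1 < α) {φ : ℝ → ℝ} (hφ : IsDelaySolution δ α φ) (hφ1 : φ 1 = 1) :
    compRatio δ (uniformLaw φ) ≤ α := by
  have hβ : 0 < 1 - δ := by linarith
  have hmono := hφ.strictMonoOn hα hδ0 hδ1
  have hc := hφ.continuousOn hα hδ0 hδ1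
  have hφ0 := hφ.zero hδ1
  have hg : MonotoneOn φ (Ico 0 1) := hmono.monotoneOn.mono Ico_subset_Icc_self
  rw [compRatio_le_iff]
  intro s hs
  obtain ⟨p, hp, hps⟩ : ∃ p ∈ Icc (0 : ℝ) 1, φ p = min s 1 := by
    refine intermediate_value_Icc zero_le_one hc ?_
    rw [hφ0, hφ1]
    exact ⟨(lt_min hs zero_lt_one).le, min_le_right _ _⟩
  have hcost : ∀ u ∈ Ioo (0 : ℝ) 1, cost s (φ u) = if u ≤ p then φ u + 1 else φ p := by
    intro u hu
    have huI := Ioo_subset_Icc_self hu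
    split_ifs with hup
    · rw [cost, if_neg (not_lt.2 ?_)]
      exact (hmono.monotoneOn huI hp hup).trans (hps.trans_le (min_le_left _ _))
    · rw [not_le] at hup
      have h1 : φ p < φ u := hmono hp huI hup
      have h2 : φ u < 1 := by rw [← hφ1]; exact hmono huI ⟨zero_le_one, le_rfl⟩ hu.2
      have h3 : φ p = s := by
        rcases min_choice s 1 with h | h <;> rw [h] at hps
        · exact hps
        · linarith
      rw [cost, if_pos (by linarith), h3]
  rw [← hps]
  have hmem := max_sub_mem_Icc hβ hp.1
  have hvol := hφ.volterra hα hδ0 hδ1 hp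
  set a := max (p - (1 - δ)) 0 with ha
  have haI : a ∈ Icc (0 : ℝ) 1 := ⟨hmem.1, hmem.2.trans hp.2⟩
  have hp1 : φ p ≤ 1 := hps.trans_le (min_le_right _ _)
  -- the excess over a threshold `τ` that separates the worst costs from the others
  have hexcess : ∀ τ, φ p ≤ τ → (∀ u ∈ Ioo 0 a, φ u + 1 ≤ τ) → (∀ u ∈ Ioo a p, τ ≤ φ u + 1) →
      ∫ u in (0 : ℝ)..1, max (cost s (φ u) - τ) 0 = coeff α (1 - δ) p * φ p - (p - a) * τ := by
    intro τ hτ hlow hhigh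
    have hd := (intervalIntegrable_cost hg hφ0.ge hs).sub (intervalIntegrable_const (c := τ))
    have hint : IntervalIntegrable (fun u ↦ max (cost s (φ u) - τ) 0) volume 0 1 :=
      ⟨hd.1.pos_part, hd.2.pos_part⟩
    have hI : ∀ b ∈ Icc (0 : ℝ) 1, ∀ c ∈ Icc (0 : ℝ) 1,
        IntervalIntegrable (fun u ↦ max (cost s (φ u) - τ) 0) volume b c := fun b hb c hc ↦
      hint.mono_set (uIcc_subset_Icc_of_mem hb hc)
    have h01 : (0 : ℝ) ∈ Icc (0 : ℝ) 1 := ⟨le_rfl, zero_le_one⟩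
    have h11 : (1 : ℝ) ∈ Icc (0 : ℝ) 1 := ⟨zero_le_one, le_rfl⟩
    rw [← intervalIntegral.integral_add_adjacent_intervals (hI 0 h01 p hp) (hI p hp 1 h11),
      ← intervalIntegral.integral_add_adjacent_intervals (hI 0 h01 a haI) (hI a haI p hp)]
    have e1 : ∫ u in (0 : ℝ)..a, max (cost s (φ u) - τ) 0 = ∫ u in (0 : ℝ)..a, (0 : ℝ) := by
      refine intervalIntegral.integral_congr_Ioo_of_le hmem.1 fun u hu ↦ ?_
      have hup : u < p := hu.2.trans_le hmem.2
      rw [hcost u ⟨hu.1, hup.trans_le hp.2⟩, if_pos hup.le,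
        max_eq_right (sub_nonpos.2 (hlow u hu))]
    have e2 : ∫ u in a..p, max (cost s (φ u) - τ) 0 = ∫ u in a..p, (φ u + 1 - τ) := by
      refine intervalIntegral.integral_congr_Ioo_of_le hmem.2 fun u hu ↦ ?_
      rw [hcost u ⟨hmem.1.trans_lt hu.1, hu.2.trans_le hp.2⟩, if_pos hu.2.le,
        max_eq_left (sub_nonneg.2 (hhigh u hu))]
    have e3 : ∫ u in p..1, max (cost s (φ u) - τ) 0 = ∫ u in p..1, (0 : ℝ) := by
      refine intervalIntegral.integral_congr_Ioo_of_le hp.2 fun u hu ↦ ?_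
      rw [hcost u ⟨hp.1.trans_lt hu.1, hu.2⟩, if_neg (not_le.2 hu.1),
        max_eq_right (sub_nonpos.2 hτ)]
    have hφI : IntervalIntegrable (fun u ↦ φ u + 1) volume a p :=
      (intervalIntegrable_delay hβ (intervalIntegrable_of_continuousOn_Icc h11 hc) hp).add
        intervalIntegrable_const
    rw [e1, e2, e3, intervalIntegral.integral_sub hφI intervalIntegrable_const, hvol]
    simp
  rcases le_total p (1 - δ) with hle | hge
  -- for `p ≤ 1 - δ` the threshold is the renting cost `φ p`, otherwise the smallest buying cost
  -- within the worst `1 - δ` fraction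
  · have ha0 : a = 0 := max_eq_right (by linarith)
    refine (cvar_le hδ0 hδ1 hg hφ0.ge hs (φ p)).trans_eq ?_
    rw [hexcess (φ p) le_rfl (by simp [ha0]) fun u hu ↦ ?_]
    · rw [coeff_of_le hle, ha0]
      field_simp
      ring
    · have := hφ.nonneg hα hδ0 hδ1 (t := u) ⟨hmem.1.trans hu.1.le, hu.2.le.trans hp.2⟩
      linarith
  · have ha0 : a = p - (1 - δ) := max_eq_left (by linarith)
    refine (cvar_le hδ0 hδ1 hg hφ0.ge hs (φ a + 1)).trans_eq ?_
    rw [hexcess (φ a + 1) ?_ (fun u hu ↦ ?_) fun u hu ↦ ?_]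
    · rw [coeff_of_ge hge, ha0]
      field_simp
      ring
    · linarith [hφ.nonneg hα hδ0 hδ1 haI]
    · have := hmono.monotoneOn ⟨hu.1.le, hu.2.le.trans haI.2⟩ haI hu.2.le
      linarith
    · have := hmono.monotoneOn haI ⟨hmem.1.trans hu.1.le, hu.2.le.trans hp.2⟩ hu.1.le
      linarith

theorem inverseCDF_uniformLaw {φ : ℝ → ℝ} (hc : ContinuousOn φ (Icc 0 1))
    (hmono : StrictMonoOn φ (Icc 0 1)) (h0 : φ 0 = 0) (h1 : φ 1 = 1) {p : ℝ}
    (hp : p ∈ Icc (0 : ℝ) 1) : inverseCDF 0 1 (uniformLaw φ) p = φ p := by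
  have hg : MonotoneOn φ (Ico 0 1) := hmono.monotoneOn.mono Ico_subset_Icc_self
  have := isProbabilityMeasure_uniformLaw hg
  have hcdf : ∀ r ∈ Icc (0 : ℝ) 1, ProbabilityTheory.cdf (uniformLaw φ) (φ r) = r := by
    intro r hr
    rw [ProbabilityTheory.cdf_eq_real, measureReal_def, uniformLaw_Iic hg hr.2
      fun u hu ↦ hmono.le_iff_le (Ioo_subset_Icc_self hu) hr, ENNReal.toReal_ofReal hr.1]
  have hbound : φ p ∈ Icc 0 1 := by
    constructor
    · rw [← h0]; exact hmono.monotoneOn ⟨le_rfl, zero_le_one⟩ hp hp.1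
    · rw [← h1]; exact hmono.monotoneOn hp ⟨zero_le_one, le_rfl⟩ hp.2
  have hset : {x ∈ Icc 0 1 | p ≤ ProbabilityTheory.cdf (uniformLaw φ) x} = Icc (φ p) 1 := by
    have hiff : ∀ x ∈ Icc (0 : ℝ) 1,
        p ≤ ProbabilityTheory.cdf (uniformLaw φ) x ↔ φ p ≤ x := by
      intro x hx
      obtain ⟨r, hr, rfl⟩ := intermediate_value_Icc zero_le_one hc (by rwa [h0, h1])
      rw [hcdf r hr, hmono.le_iff_le hp hr]
    ext x
    constructor
    · rintro ⟨hx, hpx⟩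
      exact ⟨(hiff x hx).1 hpx, hx.2⟩
    · intro hx
      have hxI : x ∈ Icc (0 : ℝ) 1 := ⟨hbound.1.trans hx.1, hx.2⟩
      exact ⟨hxI, (hiff x hxI).2 hx.1⟩
  rw [inverseCDF, hset, csInf_Icc hbound.2]

end SkiRental

theorem mainTheorem1 (δ : ℝ) (hδ0 : 0 ≤ δ) (hδ1 : δ < 1) :
    ∃ α : ℝ, 1 < α ∧ (α : EReal) = SkiRental.optRatio δ ∧
      ∃ φ : ℝ → ℝ,
        SkiRental.IsDelaySolution δ α φ ∧
        (∀ ψ : ℝ → ℝ, SkiRental.IsDelaySolution δ α ψ → Set.EqOn ψ φ (Set.Icc 0 1)) ∧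
        Set.MapsTo φ (Set.Icc 0 1) (Set.Icc 0 1) ∧
        ∃ μ : MeasureTheory.Measure ℝ,
          SkiRental.IsOptimal δ μ ∧
          (∀ ν : MeasureTheory.Measure ℝ, SkiRental.IsOptimal δ ν → ν = μ) ∧
          (∀ᵐ x ∂μ, x ∈ Set.Icc (0 : ℝ) 1) ∧
          ∀ p ∈ Set.Icc (0 : ℝ) 1, SkiRental.inverseCDF 0 1 μ p = φ p := by
  obtain ⟨α, φ, hα, hφ, hφ1⟩ := SkiRental.exists_isDelaySolution_one_eq_one hδ0 hδ1
  have hmono := hφ.strictMonoOn hα hδ0 hδ1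
  have hφ0 := hφ.zero hδ1
  have hg : MonotoneOn φ (Ico 0 1) := hmono.monotoneOn.mono Ico_subset_Icc_self
  have hmaps : MapsTo φ (Icc 0 1) (Icc 0 1) := fun t ht ↦
    ⟨hφ.nonneg hα hδ0 hδ1 ht, hφ1 ▸ hmono.monotoneOn ht ⟨zero_le_one, le_rfl⟩ ht.2⟩
  have hstrat := SkiRental.isStrategy_uniformLaw hg hφ0.ge
  have hle := hφ.compRatio_uniformLaw_le hδ0 hδ1 hα hφ1
  have hge : (α : EReal) ≤ SkiRental.optRatio δ :=
    le_iInf₂ fun ν hν ↦ SkiRental.le_compRatio hδ0 hδ1 hα hφ hφ1 hν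
  have hopt : SkiRental.optRatio δ ≤ SkiRental.compRatio δ (SkiRental.uniformLaw φ) :=
    iInf₂_le _ hstrat
  have hαopt : (α : EReal) = SkiRental.optRatio δ := le_antisymm hge (hopt.trans hle)
  refine ⟨α, hα, hαopt, φ, hφ, fun ψ hψ ↦ hφ.eqOn hα hδ0 hδ1 hψ, hmaps,
    SkiRental.uniformLaw φ, ⟨hstrat, le_antisymm (hle.trans hge) hopt⟩, ?_, ?_, ?_⟩
  · intro ν hν
    exact hφ.uniformLaw_eq_of_compRatio_le hδ0 hδ1 hα hφ1 hν.1 (hν.2.trans hαopt.symm).le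
  · refine (ae_map_iff (p := fun x ↦ x ∈ Icc 0 1) (SkiRental.aemeasurable_of_monotoneOn_Ico hg)
      measurableSet_Icc).2 ?_
    filter_upwards [ae_restrict_mem measurableSet_Ioo] with u hu
    exact hmaps (Ioo_subset_Icc_self hu)
  · exact fun p hp ↦
      SkiRental.inverseCDF_uniformLaw (hφ.continuousOn hα hδ0 hδ1) hmono hφ0 hφ1 hp
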